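/- **Theorem (strong completeness of $\mathbf{NSF_P}$).** Let $\mathcal L$ be a countable first-order language (individual constants, function symbols, predicate symbols of any finite arities) with a distinguished unary predicate $E$. Formulas are built from atoms $P(t_1,\dots,t_n)$, $\top$, $\bot$ by the primitive operations $\wedge,\vee,\to,\neg,\forall,\exists$, and are identified up to renaming of bound variables; $\mathord{\sim}A$ abbreviates $A\to\bot$. For every finite set $\Gamma$ of closed formulas and every closed formula $A$: if $\Gamma\models^V_W A$ for every prevalent model $W$, then $\Gamma\vdash_{\mathbf{NSF_P}}A$. The notions are as follows. *Classes of formulas.* GN: $N ::= \bot\mid\neg A\mid N\wedge N\mid N\vee N\mid N\to N\mid\forall xN\mid\exists xN$ ($A$ any formula). A variable $x$ *occurs only globally* in $A$ if it occurs free in $A$ and each of its free occurrences lies in a GN subformula of $A$. Quantification of $x$ over $A$ is *global* if $x$ occurs only globally in $A$, and *local* otherwise (so vacuous quantification is local). ST: $S ::= \top\mid N\mid S\wedge S\mid S\vee N\mid N\vee S\mid A\to B\mid\forall xA$ ($N$ in GN; $A,B$ any formulas). ST$_{\mathrm P}$: $S' ::= S\mid S'\vee S'\mid\exists xS'$ ($S$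 in ST; $\exists xS'$ global). *Models.* A strict finitistic model $W=\langle K,\le,D,J,v\rangle$ consists of a rooted tree $\langle K,\le\rangle$ of height at most $\omega$ with at most countable branching; a nonempty set $D$; an interpretation $J$ of the constants and function symbols in $D$, extended to the closed terms of $\mathcal L(D)$ (the language with a name $\overline d$ for each $d\in D$); and, for each node $k$ and $n$-ary predicate $P$, an extension $P^{v(k)}\subseteq D^n$, increasing in $k$, such that (strictness) $\langle J(c_1),\dots,J(c_n)\rangle\in P^{v(k)}$ implies $J(c')\in E^{v(k)}$ for every subterm $c'$ of every $c_i$, and (finite verification) for each $k$ only finitely many $P$ have $P^{v(k)}\ne\emptyset$. *Forcing*, for closed formulas of $\mathcal L(D)$: $k\models\top$; $k\not\models\bot$; $k\models P(c_1,\dots,c_n)$ iff $\langle J(c_1),\dots,J(c_n)\rangle\in P^{v(k)}$; $\wedge,\vee$ are evaluated at $k$; $k\models A\to B$ iff for every $k'\ge k$ with $k'\models A$ there is $k''\ge k'$ with $k''\models B$; $k\models\neg A$ iff $l\not\models A$ for all $l\in K$. If the quantification is global, $k\models\forall xA$ iff $k\models\top\to A[\overline d/x]$ for all $d\in D$, and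 $k\models\exists xA$ iff $k\models A[\overline d/x]$ for some $d\in D$; if it is local, $k\models\forall xA$ iff $k\models E(\overline d)\to A[\overline d/x]$ for all $d$, and $k\models\exists xA$ iff $k\models E(\overline d)\wedge A[\overline d/x]$ for some $d$. $W$ is *prevalent* if (i) every closed formula of $\mathcal L(D)$ that is forced at some node is, for every $k$, forced at some $k'\ge k$, and (ii) for all $d\in D$ and all $k$ there is $k'\ge k$ with $k'\models E(\overline d)$. For closed formulas, $\Gamma\models^V_WA$ means that every node of $W$ that forces all members of $\Gamma$ forces $A$. *The system.* $\Gamma\vdash_{\mathbf{NSF_P}}A$ means that $A$ has a natural deduction derivation with open hypotheses from a finite subset of $\Gamma$ by the following rules: the usual introduction and elimination rules for $\wedge,\vee$; $\top$; from $\bot$ infer any $A$; from $P(t_1,\dots,t_n)$ infer $E(t_i)$; from $E(f(t_1,\dots,t_n))$ infer $E(t_i)$; from $\mathord{\sim}\mathord{\sim}S$ infer $S$, for $S$ in ST$_{\mathrm P}$; ($\to$I) from a derivation of $\mathord{\sim}\mathord{\sim}B$ from $[A]$ infer $A\to B$; ($\to$E) from $A\to B$ and $A$ infer $\mathord{\sim}\mathord{\sim}B$;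 from $\mathord{\sim}A$ infer $\neg A$; from $\neg A$ and $A$ infer $\bot$; the axioms $\neg\neg A\to A$ (any $A$) and $\forall x\neg\neg E(x)$; ($\forall$I) from $\mathord{\sim}\mathord{\sim}A(x)$ infer $\forall xA$, where $x$ is not free in the open hypotheses; ($\forall$E) from $\forall xA$ infer $\mathord{\sim}\mathord{\sim}A[t/x]$; ($\exists$I) from $A[t/x]$, and also $E(t)$ if the quantification is local, infer $\exists xA$; ($\exists$E) from $\exists yA$ and a derivation of $C$ from $[A[x/y]]$, and also $[E(x)]$ if the quantification is local, infer $C$, where $x$ is not free in $\exists yA$, $C$ or the other open hypotheses of the derivation of $C$. -/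

import Mathlib

namespace SFQ

/-! # Syntax

A language is a first-order language `L` (individual constants are the function symbols of arity 0)
together with a distinguished unary predicate symbol `E : L.Relations 1`, the existence predicate.
Terms are Mathlib's terms over the variables `v₀, v₁, …`, indexed by `ℕ`.

Formulas are taken up to renaming of bound variables, by means of de Bruijn indices: in `all A`
and `ex A` the quantifier binds the variable `0` of `A`, and the variable `n + 1` of `A` is
the variable `n` of the quantified formula. -/

/-- Formulas; all of `⊤`, `⊥`, `∧`, `∨`, `→`, `¬`, `∀`, `∃` are primitive. -/
inductive Fm (L : FirstOrder.Language.{0, 0}) : Type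
  | top : Fm L
  | bot : Fm L
  | rel {n : ℕ} (P : L.Relations n) (ts : Fin n → L.Term ℕ) : Fm L
  | and (A B : Fm L) : Fm L
  | or (A B : Fm L) : Fm L
  | imp (A B : Fm L) : Fm L
  | neg (A : Fm L) : Fm L
  | all (A : Fm L) : Fm L
  | ex (A : Fm L) : Fm L

/-- `d` in position `0`, followed by `e 0, e 1, …`. -/
def scons {X : Type} (d : X) (e : ℕ → X) : ℕ → X
  | 0 => d
  | n + 1 => e n

namespace Fm

variable {L : FirstOrder.Language.{0, 0}}

/-- The weak negation `A → ⊥`, an abbreviation. -/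
abbrev wneg (A : Fm L) : Fm L := imp A bot

/-- The atomic formula `E(t)`. -/
abbrev exi (E : L.Relations 1) (t : L.Term ℕ) : Fm L := rel E ![t]

/-- Simultaneous capture-avoiding substitution of the terms `σ 0, σ 1, …` for the variables
`0, 1, …`. -/
def subst : Fm L → (ℕ → L.Term ℕ) → Fm L
  | top, _ => top
  | bot, _ => bot
  | rel P ts, σ => rel P fun i => (ts i).subst σ
  | and A B, σ => and (A.subst σ) (B.subst σ)
  | or A B, σ => or (A.subst σ) (B.subst σ)
  | imp A B, σ => imp (A.subst σ) (B.subst σ)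
  | neg A, σ => neg (A.subst σ)
  | all A, σ => all (A.subst (scons (.var 0) fun n => (σ n).relabel Nat.succ))
  | ex A, σ => ex (A.subst (scons (.var 0) fun n => (σ n).relabel Nat.succ))

/-- `A[t/x]`, where `x` is the variable bound in `all A` and `ex A`. -/
def inst (A : Fm L) (t : L.Term ℕ) : Fm L := A.subst (scons t .var)

/-- The formula `A` with every free variable `n` written as `n + 1`: this makes `0` a fresh
variable. -/
def lift (A : Fm L) : Fm L := A.subst fun n => .var (n + 1)

/-- `A.Free x`: the variable `x` occurs free in `A`. -/
def Free : Fm L → ℕ → Prop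
  | top, _ => False
  | bot, _ => False
  | rel _ ts, x => ∃ i, x ∈ (ts i).varFinset
  | and A B, x => A.Free x ∨ B.Free x
  | or A B, x => A.Free x ∨ B.Free x
  | imp A B, x => A.Free x ∨ B.Free x
  | neg A, x => A.Free x
  | all A, x => A.Free (x + 1)
  | ex A, x => A.Free (x + 1)

/-- Closed formulas. -/
def Closed (A : Fm L) : Prop := ∀ x, ¬ A.Free x

/-- The global negative formulas
`N ::= ⊥ | ¬ A | N ∧ N | N ∨ N | N → N | ∀ x N | ∃ x N`, with `A` any formula. -/
inductive GN : Fm L → Prop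
  | bot : GN bot
  | neg (A : Fm L) : GN (neg A)
  | and {M N : Fm L} : GN M → GN N → GN (and M N)
  | or {M N : Fm L} : GN M → GN N → GN (or M N)
  | imp {M N : Fm L} : GN M → GN N → GN (imp M N)
  | all {N : Fm L} : GN N → GN (all N)
  | ex {N : Fm L} : GN N → GN (ex N)

/-- `A.NonGlobal x`: the variable `x` has a free occurrence in `A` that lies in no global negative
subformula of `A` (neither in `A` itself nor in a proper subformula). -/
def NonGlobal : Fm L → ℕ → Prop
  | top, _ => False
  | bot, _ => False
  | rel P ts, x => (rel P ts).Free x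
  | and A B, x => ¬ (and A B).GN ∧ (A.NonGlobal x ∨ B.NonGlobal x)
  | or A B, x => ¬ (or A B).GN ∧ (A.NonGlobal x ∨ B.NonGlobal x)
  | imp A B, x => ¬ (imp A B).GN ∧ (A.NonGlobal x ∨ B.NonGlobal x)
  | neg _, _ => False
  | all A, x => ¬ (all A).GN ∧ A.NonGlobal (x + 1)
  | ex A, x => ¬ (ex A).GN ∧ A.NonGlobal (x + 1)

/-- `x` occurs free in `A`, and only globally. A variable that does not occur in `A` does not
occur only globally, so that vacuous quantification is local. -/
def OnlyGlobal (A : Fm L) (x : ℕ) : Prop := A.Free x ∧ ¬ A.NonGlobal x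

/-- The class `ST`: `S ::= ⊤ | N | S ∧ S | S ∨ N | N ∨ S | A → B | ∀ x A`, with `N` global negative
and `A`, `B` any formulas. -/
inductive ST : Fm L → Prop
  | top : ST top
  | gn {N : Fm L} : GN N → ST N
  | and {S T : Fm L} : ST S → ST T → ST (and S T)
  | or_gn {S N : Fm L} : ST S → GN N → ST (or S N)
  | gn_or {N S : Fm L} : GN N → ST S → ST (or N S)
  | imp (A B : Fm L) : ST (imp A B)
  | all (A : Fm L) : ST (all A)

/-- The class `ST_P`: `S' ::= S | S' ∨ S' | ∃ x S'`, with `S` in `ST`, and where `x` occurs only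
globally in the `S'` of `∃ x S'`. -/
inductive STP : Fm L → Prop
  | st {S : Fm L} : ST S → STP S
  | or {S T : Fm L} : STP S → STP T → STP (or S T)
  | ex {S : Fm L} : STP S → S.OnlyGlobal 0 → STP (ex S)

end Fm

/-! # The natural deduction system `NSF_P` -/

open Fm in
/-- `Deriv E Γ A`: there is a natural deduction derivation in `NSF_P` of `A` with open hypotheses
among `Γ`. A discharged hypothesis is one that is added to `Γ` in the premise. In the rules with
a variable condition (`all_intro` and the two `∃`-eliminations) the proper variable is `0`, and the
other formulas of the premise are lifted, so that it does not occur free in them. -/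
inductive Deriv {L : FirstOrder.Language.{0, 0}} (E : L.Relations 1) : Set (Fm L) → Fm L → Prop
  | hyp {Γ : Set (Fm L)} {A : Fm L} : A ∈ Γ → Deriv E Γ A
  | top_intro {Γ : Set (Fm L)} : Deriv E Γ top
  | bot_elim {Γ : Set (Fm L)} {A : Fm L} : Deriv E Γ bot → Deriv E Γ A
  | and_intro {Γ : Set (Fm L)} {A B : Fm L} : Deriv E Γ A → Deriv E Γ B → Deriv E Γ (and A B)
  | and_left {Γ : Set (Fm L)} {A B : Fm L} : Deriv E Γ (and A B) → Deriv E Γ A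
  | and_right {Γ : Set (Fm L)} {A B : Fm L} : Deriv E Γ (and A B) → Deriv E Γ B
  | or_inl {Γ : Set (Fm L)} {A B : Fm L} : Deriv E Γ A → Deriv E Γ (or A B)
  | or_inr {Γ : Set (Fm L)} {A B : Fm L} : Deriv E Γ B → Deriv E Γ (or A B)
  | or_elim {Γ : Set (Fm L)} {A B C : Fm L} : Deriv E Γ (or A B) →
      Deriv E (insert A Γ) C → Deriv E (insert B Γ) C → Deriv E Γ C
  /-- STR₁ -/
  | str_one {Γ : Set (Fm L)} {n : ℕ} {P : L.Relations n} {ts : Fin n → L.Term ℕ} (i : Fin n) :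
      Deriv E Γ (rel P ts) → Deriv E Γ (exi E (ts i))
  /-- STR₂ -/
  | str_two {Γ : Set (Fm L)} {n : ℕ} {f : L.Functions n} {ts : Fin n → L.Term ℕ} (i : Fin n) :
      Deriv E Γ (exi E (.func f ts)) → Deriv E Γ (exi E (ts i))
  /-- ST_P -/
  | stable {Γ : Set (Fm L)} {S : Fm L} : STP S → Deriv E Γ (wneg (wneg S)) → Deriv E Γ S
  | imp_intro {Γ : Set (Fm L)} {A B : Fm L} :
      Deriv E (insert A Γ) (wneg (wneg B)) → Deriv E Γ (imp A B)
  | imp_elim {Γ : Set (Fm L)} {A B : Fm L} :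
      Deriv E Γ (imp A B) → Deriv E Γ A → Deriv E Γ (wneg (wneg B))
  /-- ¬ I_P -/
  | neg_intro {Γ : Set (Fm L)} {A : Fm L} : Deriv E Γ (wneg A) → Deriv E Γ (neg A)
  | neg_elim {Γ : Set (Fm L)} {A : Fm L} : Deriv E Γ (neg A) → Deriv E Γ A → Deriv E Γ bot
  /-- DNE -/
  | dne {Γ : Set (Fm L)} (A : Fm L) : Deriv E Γ (imp (neg (neg A)) A)
  /-- Obj -/
  | obj {Γ : Set (Fm L)} : Deriv E Γ (all (neg (neg (exi E (.var 0)))))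
  /-- ∀ I_P -/
  | all_intro {Γ : Set (Fm L)} {A : Fm L} :
      Deriv E (lift '' Γ) (wneg (wneg A)) → Deriv E Γ (all A)
  /-- ∀ E_P -/
  | all_elim {Γ : Set (Fm L)} {A : Fm L} (t : L.Term ℕ) :
      Deriv E Γ (all A) → Deriv E Γ (wneg (wneg (A.inst t)))
  /-- ∃-glo I -/
  | ex_glo_intro {Γ : Set (Fm L)} {A : Fm L} (t : L.Term ℕ) : A.OnlyGlobal 0 →
      Deriv E Γ (A.inst t) → Deriv E Γ (ex A)
  /-- ∃-loc I -/
  | ex_loc_intro {Γ : Set (Fm L)} {A : Fm L} (t : L.Term ℕ) : ¬ A.OnlyGlobal 0 →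
      Deriv E Γ (A.inst t) → Deriv E Γ (exi E t) → Deriv E Γ (ex A)
  /-- ∃-glo E -/
  | ex_glo_elim {Γ : Set (Fm L)} {A C : Fm L} : A.OnlyGlobal 0 →
      Deriv E Γ (ex A) → Deriv E (insert A (lift '' Γ)) C.lift → Deriv E Γ C
  /-- ∃-loc E -/
  | ex_loc_elim {Γ : Set (Fm L)} {A C : Fm L} : ¬ A.OnlyGlobal 0 →
      Deriv E Γ (ex A) →
      Deriv E (insert A (insert (exi E (.var 0)) (lift '' Γ))) C.lift → Deriv E Γ C

/-- `Γ ⊢ A` in `NSF_P`: there is a derivation of `A` from a finite subset of `Γ`. -/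
def Derivable {L : FirstOrder.Language.{0, 0}} (E : L.Relations 1) (Γ : Set (Fm L)) (A : Fm L) : Prop :=
  ∃ Γ' : Set (Fm L), Γ' ⊆ Γ ∧ Γ'.Finite ∧ Deriv E Γ' A

/-! # Strict finitistic models -/

/-- The subterms of a term (including the term itself). -/
def subterms {L : FirstOrder.Language.{0, 0}} {X : Type} : L.Term X → Set (L.Term X)
  | .var x => {.var x}
  | .func f ts => {.func f ts} ∪ ⋃ i, subterms (ts i)

/-- The interpretation `J` of closed terms that is determined by an interpretation `fn` of the
constants and function symbols over a domain `D`. A closed term of the language `L(D)`, in which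
every `d ∈ D` has a name, is a term of `L` with names of elements of `D` in place of variables. -/
def interp {L : FirstOrder.Language.{0, 0}} {D : Type}
    (fn : ∀ {n : ℕ}, L.Functions n → (Fin n → D) → D) : L.Term D → D
  | .var d => d
  | .func f ts => fn f fun i => interp fn (ts i)

/-- Strict finitistic models with respect to the language `L` with existence predicate `E`. -/
structure Model (L : FirstOrder.Language.{0, 0}) (E : L.Relations 1) where
  /-- The nodes. -/
  K : Type
  [order : PartialOrder K]
  /-- The frame is rooted. -/
  rooted : ∃ r : K, ∀ k, r ≤ k
  /-- The frame is tree-like. -/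
  tree : ∀ k : K, IsChain (· ≤ ·) (Set.Iic k)
  /-- The height of the tree is at most `ω`. -/
  height : ∀ k : K, (Set.Iic k).Finite
  /-- Every node has at most countably many immediate successors. -/
  branching : ∀ k : K, {k' : K | k ⋖ k'}.Countable
  /-- The constant domain. -/
  D : Type
  [nonempty : Nonempty D]
  /-- The interpretation of the constants and function symbols. -/
  fn : ∀ {n : ℕ}, L.Functions n → (Fin n → D) → D
  /-- The extension of a predicate at a node. -/
  v : K → ∀ {n : ℕ}, L.Relations n → Set (Fin n → D)
  /-- The extensions grow along the order. -/
  mono : ∀ {k k' : K}, k ≤ k' → ∀ {n : ℕ} (P : L.Relations n), v k P ⊆ v k' P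
  /-- The strictness condition. -/
  strict : ∀ (k : K) {n : ℕ} (P : L.Relations n) (c : Fin n → L.Term D),
    (fun i => interp fn (c i)) ∈ v k P → ∀ i, ∀ c' ∈ subterms (c i), ![interp fn c'] ∈ v k E
  /-- The finite verification condition. -/
  finite_verification : ∀ k : K, {P : Σ n, L.Relations n | (v k P.2).Nonempty}.Finite

attribute [instance] Model.order Model.nonempty

namespace Model

variable {L : FirstOrder.Language.{0, 0}} {E : L.Relations 1}

/-- Actual verification `k ⊨ A`, where `A` is the closed formula of `L(D)` that arises from the
given formula by putting the name of `e n` for every free variable `n`. -/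
def Forces (W : Model L E) : Fm L → W.K → (ℕ → W.D) → Prop
  | .top, _, _ => True
  | .bot, _, _ => False
  | .rel P ts, k, e => (fun i => interp W.fn ((ts i).relabel e)) ∈ W.v k P
  | .and A B, k, e => W.Forces A k e ∧ W.Forces B k e
  | .or A B, k, e => W.Forces A k e ∨ W.Forces B k e
  | .imp A B, k, e => ∀ k' ≥ k, W.Forces A k' e → ∃ k'' ≥ k', W.Forces B k'' e
  | .neg A, _, e => ∀ l : W.K, ¬ W.Forces A l e
  | .all A, k, e =>
      -- global: `k ⊨ ⊤ → A[d]` for all `d`; local: `k ⊨ E(d) → A[d]` for all `d`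
      (A.OnlyGlobal 0 → ∀ d : W.D, ∀ k' ≥ k, ∃ k'' ≥ k', W.Forces A k'' (scons d e)) ∧
      (¬ A.OnlyGlobal 0 → ∀ d : W.D, ∀ k' ≥ k, ![d] ∈ W.v k' E →
        ∃ k'' ≥ k', W.Forces A k'' (scons d e))
  | .ex A, k, e =>
      -- global: `k ⊨ A[d]` for some `d`; local: `k ⊨ E(d) ∧ A[d]` for some `d`
      (A.OnlyGlobal 0 → ∃ d : W.D, W.Forces A k (scons d e)) ∧
      (¬ A.OnlyGlobal 0 → ∃ d : W.D, ![d] ∈ W.v k E ∧ W.Forces A k (scons d e))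

/-- Assertibility of the closed formula of `L(D)` given by `A` and `e`: it is verified at some
node. -/
def Assertible (W : Model L E) (A : Fm L) (e : ℕ → W.D) : Prop := ∃ k, W.Forces A k e

/-- Prevalence of the closed formula of `L(D)` given by `A` and `e`: every node has a later node
at which it is verified. -/
def PrevalentIn (W : Model L E) (A : Fm L) (e : ℕ → W.D) : Prop :=
  ∀ k, ∃ k' ≥ k, W.Forces A k' e

/-- The prevalent models: those with the formula prevalence property and the object prevalence
property. -/
def IsPrevalent (W : Model L E) : Prop :=
  (∀ (A : Fm L) (e : ℕ → W.D), W.Assertible A e → W.PrevalentIn A e) ∧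
  (∀ d : W.D, ∀ k, ∃ k' ≥ k, ![d] ∈ W.v k' E)

/-- Semantic consequence in a model: at every node, and for all values of the free variables such
that the existence predicate holds of the values of those that do not occur only globally in the
formulas concerned, if all of `Γ` is verified, then so is `A`. -/
def Consequence (W : Model L E) (Γ : Set (Fm L)) (A : Fm L) : Prop :=
  ∀ (k : W.K) (e : ℕ → W.D),
    (∀ x, (∃ B ∈ insert A Γ, B.NonGlobal x) → ![e x] ∈ W.v k E) →
    (∀ B ∈ Γ, W.Forces B k e) → W.Forces A k e

end Model

/-- Semantic consequence in the class of all prevalent models. -/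
def PrevalentConsequence {L : FirstOrder.Language.{0, 0}} (E : L.Relations 1) (Γ : Set (Fm L)) (A : Fm L) :
    Prop :=
  ∀ W : Model L E, W.IsPrevalent → W.Consequence Γ A

end SFQ

/-! Suppose `Γ` does not derive `A`. Weak negation implies strong negation, and every GN formula is
stable, so `¬B ∨ ¬¬B` is a theorem (`em_neg`). Hence logic is classical under `¬¬`: if `Δ` is
saturated, `{B | ¬¬B ∈ Δ}` behaves as a complete Henkin theory, in which even the existence side
conditions disappear because `¬¬E(t)` is a theorem. `Δ` itself stays merely prime and witnessed.

`exists_saturated` puts `Γ` in such a `Δ` omitting `A`. The countermodel is the chain `ℕ` over the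
domain of all terms. Its root verifies atoms of `Δ`; later nodes also verify atoms `B` with `¬¬B ∈
Δ`. Finite verification is secured by releasing predicates in finite stages `S k`.

Two truth lemmas carry the proof. `canonicalModel_assertible`: if `¬¬B ∈ Δ` then `B` is prevalent,
and if `B` is assertible then `¬¬B ∈ Δ`; so the model is prevalent. `canonicalModel_forces_root`:
for formulas over `S 0`, forcing at the root is membership in `Δ`. There `→`, `¬`, `∀` reduce to the
first lemma because such formulas are stable, while the other operations use saturation. The root
then forces `Γ` but not `A`. -/

namespace SFQ

open FirstOrder Language

/-! # Substitution calculus -/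

section TermSubst

variable {L : FirstOrder.Language.{0, 0}}

theorem term_subst_subst {X Y Z : Type} (t : L.Term X) (σ : X → L.Term Y) (τ : Y → L.Term Z) :
    (t.subst σ).subst τ = t.subst fun n => (σ n).subst τ := by
  induction t with
  | var => rfl
  | func f ts ih => simp [Term.subst, ih]

theorem term_relabel_eq_subst {X Y : Type} (t : L.Term X) (ρ : X → Y) :
    t.relabel ρ = t.subst fun n => .var (ρ n) := by
  induction t with
  | var => rfl
  | func f ts ih => simp [Term.subst, Term.relabel, ih]

theorem term_subst_var {X : Type} (t : L.Term X) : t.subst .var = t := by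
  induction t with
  | var => rfl
  | func f ts ih => simp [Term.subst, ih]

theorem term_subst_congr {X Y : Type} [DecidableEq X] (t : L.Term X) {σ τ : X → L.Term Y}
    (h : ∀ x ∈ t.varFinset, σ x = τ x) : t.subst σ = t.subst τ := by
  induction t with
  | var x => exact h x (by simp [Term.varFinset])
  | func f ts ih =>
    simp only [Term.subst, Term.func.injEq, heq_eq_eq, true_and]
    funext i
    exact ih i fun x hx => h x (by
      simp only [Term.varFinset, Finset.mem_biUnion, Finset.mem_univ, true_and]; exact ⟨i, hx⟩)

theorem mem_varFinset_subst {X Y : Type} [DecidableEq X] [DecidableEq Y] (t : L.Term X)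
    (σ : X → L.Term Y) (y : Y) :
    y ∈ (t.subst σ).varFinset ↔ ∃ x ∈ t.varFinset, y ∈ (σ x).varFinset := by
  induction t with
  | var x => simp [Term.subst, Term.varFinset]
  | func f ts ih =>
    simp only [Term.subst, Term.varFinset, Finset.mem_biUnion, Finset.mem_univ, true_and, ih]
    constructor
    · rintro ⟨i, x, hx, hy⟩; exact ⟨x, ⟨i, hx⟩, hy⟩
    · rintro ⟨x, ⟨i, hx⟩, hy⟩; exact ⟨i, x, hx, hy⟩

end TermSubst

theorem scons_succ {X : Type} (d : X) (e : ℕ → X) (n : ℕ) : scons d e (n + 1) = e n := rfl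

/-- The substitution `σ` carried under a binder. -/
def up {L : FirstOrder.Language.{0, 0}} (σ : ℕ → L.Term ℕ) : ℕ → L.Term ℕ :=
  scons (.var 0) fun n => (σ n).relabel Nat.succ

section Up

variable {L : FirstOrder.Language.{0, 0}}

theorem up_var : up (.var : ℕ → L.Term ℕ) = .var := by
  funext n; cases n <;> rfl

theorem up_comp (σ τ : ℕ → L.Term ℕ) :
    (fun n => (up σ n).subst (up τ)) = up fun n => (σ n).subst τ := by
  funext n
  cases n with
  | zero => rfl
  | succ n =>
    simp only [up, scons_succ, term_relabel_eq_subst, term_subst_subst, Term.subst]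

theorem up_scons (σ τ : ℕ → L.Term ℕ) (t : L.Term ℕ) :
    (fun n => (up σ n).subst (scons t τ)) = scons t fun n => (σ n).subst τ := by
  funext n
  cases n with
  | zero => rfl
  | succ n => simp only [up, scons_succ, term_relabel_eq_subst, term_subst_subst, Term.subst]

theorem mem_varFinset_up_zero (σ : ℕ → L.Term ℕ) (x : ℕ) :
    0 ∈ (up σ x).varFinset ↔ x = 0 := by
  cases x with
  | zero => simp [up, scons, Term.varFinset]
  | succ n =>
    simp [up, scons, term_relabel_eq_subst, mem_varFinset_subst, Term.varFinset]

theorem exists_mem_varFinset_up_succ (σ : ℕ → L.Term ℕ) (p : ℕ → Prop) (y : ℕ) :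
    (∃ x, p x ∧ y + 1 ∈ (up σ x).varFinset) ↔ ∃ x, p (x + 1) ∧ y ∈ (σ x).varFinset := by
  have key : ∀ x, y + 1 ∈ (up σ (x + 1)).varFinset ↔ y ∈ (σ x).varFinset := fun x => by
    simp [up, scons, term_relabel_eq_subst, mem_varFinset_subst, Term.varFinset]
  constructor
  · rintro ⟨x, hp, hx⟩
    cases x with
    | zero => simp [up, scons, Term.varFinset] at hx
    | succ x => exact ⟨x, hp, (key x).1 hx⟩
  · rintro ⟨x, hp, hx⟩
    exact ⟨x + 1, hp, (key x).2 hx⟩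

end Up

/-! ### Substitution in formulas and invariance of the syntactic classes. -/

namespace Fm

variable {L : FirstOrder.Language.{0, 0}}

theorem subst_all (A : Fm L) (σ : ℕ → L.Term ℕ) : (all A).subst σ = all (A.subst (up σ)) := rfl

theorem subst_ex (A : Fm L) (σ : ℕ → L.Term ℕ) : (ex A).subst σ = ex (A.subst (up σ)) := rfl

theorem subst_exi (E : L.Relations 1) (t : L.Term ℕ) (σ : ℕ → L.Term ℕ) :
    (exi E t).subst σ = exi E (t.subst σ) := by
  simp only [subst, rel.injEq, heq_eq_eq, true_and]
  funext i
  fin_cases i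
  rfl

theorem subst_var (A : Fm L) : A.subst .var = A := by
  induction A with
  | top | bot => rfl
  | rel P ts => simp [subst, term_subst_var]
  | and A B iA iB | or A B iA iB | imp A B iA iB => simp [subst, iA, iB]
  | neg A iA => simp [subst, iA]
  | all A iA => rw [subst_all, up_var, iA]
  | ex A iA => rw [subst_ex, up_var, iA]

theorem subst_subst (A : Fm L) (σ τ : ℕ → L.Term ℕ) :
    (A.subst σ).subst τ = A.subst fun n => (σ n).subst τ := by
  induction A generalizing σ τ with
  | top | bot => rfl
  | rel P ts => simp [subst, term_subst_subst]
  | and A B iA iB | or A B iA iB | imp A B iA iB => simp [subst, iA, iB]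
  | neg A iA => simp [subst, iA]
  | all A iA => rw [subst_all, subst_all, iA, up_comp, subst_all]
  | ex A iA => rw [subst_ex, subst_ex, iA, up_comp, subst_ex]

theorem subst_congr (A : Fm L) {σ τ : ℕ → L.Term ℕ} (h : ∀ x, A.Free x → σ x = τ x) :
    A.subst σ = A.subst τ := by
  induction A generalizing σ τ with
  | top | bot => rfl
  | rel P ts =>
    simp only [subst, rel.injEq, heq_eq_eq, true_and]
    exact funext fun i => term_subst_congr _ fun x hx => h x ⟨i, hx⟩
  | and A B iA iB | or A B iA iB | imp A B iA iB =>
    simp only [subst]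
    rw [iA fun x hx => h x (Or.inl hx), iB fun x hx => h x (Or.inr hx)]
  | neg A iA => simp only [subst]; rw [iA h]
  | all A iA | ex A iA =>
    simp only [subst_all, subst_ex]
    rw [iA fun x hx => ?_]
    cases x with
    | zero => rfl
    | succ x => simp only [up, scons_succ]; rw [h x hx]

theorem inst_subst (A : Fm L) (t : L.Term ℕ) (σ : ℕ → L.Term ℕ) :
    (A.inst t).subst σ = (A.subst (up σ)).inst (t.subst σ) := by
  rw [inst, inst, subst_subst, subst_subst, up_scons]
  congr 1
  funext n
  cases n with
  | zero => rfl
  | succ n => simp only [scons_succ, Term.subst, term_subst_var]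

theorem subst_scons (A : Fm L) (t : L.Term ℕ) (σ : ℕ → L.Term ℕ) :
    A.subst (scons t σ) = (A.subst (up σ)).inst t := by
  rw [inst, subst_subst, up_scons]
  simp only [term_subst_var]

theorem lift_subst (A : Fm L) (σ : ℕ → L.Term ℕ) :
    A.lift.subst (up σ) = (A.subst σ).lift := by
  rw [lift, lift, subst_subst, subst_subst]
  congr 1
  funext n
  simp only [up, Term.subst, scons_succ, term_relabel_eq_subst]

/-- Instantiating the body of a lifted quantified formula with the fresh variable. -/
theorem lift_body_inst (A : Fm L) :
    (A.subst (up fun n => .var (n + 1))).inst (.var 0) = A := by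
  rw [← subst_scons]
  conv_rhs => rw [← subst_var A]
  congr 1
  funext n
  cases n <;> rfl

theorem free_subst (A : Fm L) (σ : ℕ → L.Term ℕ) (y : ℕ) :
    (A.subst σ).Free y ↔ ∃ x, A.Free x ∧ y ∈ (σ x).varFinset := by
  induction A generalizing σ y with
  | top | bot => simp [subst, Free]
  | rel P ts =>
    simp only [subst, Free, mem_varFinset_subst]
    constructor
    · rintro ⟨i, x, hx, hy⟩; exact ⟨x, ⟨i, hx⟩, hy⟩
    · rintro ⟨x, ⟨i, hx⟩, hy⟩; exact ⟨i, x, hx, hy⟩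
  | and A B iA iB | or A B iA iB | imp A B iA iB =>
    simp only [subst, Free, iA, iB, or_and_right, exists_or]
  | neg A iA => simp only [subst, Free, iA]
  | all A iA | ex A iA =>
    simp only [subst_all, subst_ex, Free, iA]
    exact exists_mem_varFinset_up_succ σ A.Free y

theorem gn_subst (A : Fm L) (σ : ℕ → L.Term ℕ) : (A.subst σ).GN ↔ A.GN := by
  induction A generalizing σ with
  | top => exact Iff.rfl
  | bot => exact Iff.rfl
  | rel P ts => exact ⟨by rintro ⟨⟩, by rintro ⟨⟩⟩
  | and A B iA iB =>
    exact ⟨fun h => by cases h with | and h₁ h₂ => exact .and ((iA σ).1 h₁) ((iB σ).1 h₂),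
      fun h => by cases h with | and h₁ h₂ => exact .and ((iA σ).2 h₁) ((iB σ).2 h₂)⟩
  | or A B iA iB =>
    exact ⟨fun h => by cases h with | or h₁ h₂ => exact .or ((iA σ).1 h₁) ((iB σ).1 h₂),
      fun h => by cases h with | or h₁ h₂ => exact .or ((iA σ).2 h₁) ((iB σ).2 h₂)⟩
  | imp A B iA iB =>
    exact ⟨fun h => by cases h with | imp h₁ h₂ => exact .imp ((iA σ).1 h₁) ((iB σ).1 h₂),
      fun h => by cases h with | imp h₁ h₂ => exact .imp ((iA σ).2 h₁) ((iB σ).2 h₂)⟩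
  | neg A iA => exact ⟨fun _ => .neg _, fun _ => .neg _⟩
  | all A iA =>
    exact ⟨fun h => by cases h with | all h => exact .all ((iA _).1 h),
      fun h => by cases h with | all h => exact .all ((iA _).2 h)⟩
  | ex A iA =>
    exact ⟨fun h => by cases h with | ex h => exact .ex ((iA _).1 h),
      fun h => by cases h with | ex h => exact .ex ((iA _).2 h)⟩

theorem nonGlobal_subst (A : Fm L) (σ : ℕ → L.Term ℕ) (y : ℕ) :
    (A.subst σ).NonGlobal y ↔ ∃ x, A.NonGlobal x ∧ y ∈ (σ x).varFinset := by
  induction A generalizing σ y with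
  | top | bot => simp [subst, NonGlobal]
  | rel P ts => exact free_subst (rel P ts) σ y
  | and A B iA iB =>
    have h := gn_subst (and A B) σ
    simp only [subst] at h
    simp only [subst, NonGlobal, h, iA, iB, or_and_right, exists_or, and_assoc, exists_and_left]
  | or A B iA iB =>
    have h := gn_subst (or A B) σ
    simp only [subst] at h
    simp only [subst, NonGlobal, h, iA, iB, or_and_right, exists_or, and_assoc, exists_and_left]
  | imp A B iA iB =>
    have h := gn_subst (imp A B) σ
    simp only [subst] at h
    simp only [subst, NonGlobal, h, iA, iB, or_and_right, exists_or, and_assoc, exists_and_left]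
  | neg A iA => simp only [subst, NonGlobal, false_and, exists_false]
  | all A iA =>
    have h := gn_subst (all A) σ
    simp only [subst_all] at h
    simp only [subst_all, NonGlobal, h, iA, and_assoc, exists_and_left,
      exists_mem_varFinset_up_succ σ A.NonGlobal y]
  | ex A iA =>
    have h := gn_subst (ex A) σ
    simp only [subst_ex] at h
    simp only [subst_ex, NonGlobal, h, iA, and_assoc, exists_and_left,
      exists_mem_varFinset_up_succ σ A.NonGlobal y]

/-- Under a binder, only the bound variable is mapped to a term containing `0`. Thus substitution
never turns a global quantifier into a local one or conversely, so the quantifier rules survive it.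
-/
theorem onlyGlobal_subst_up (A : Fm L) (σ : ℕ → L.Term ℕ) :
    (A.subst (up σ)).OnlyGlobal 0 ↔ A.OnlyGlobal 0 := by
  simp only [OnlyGlobal, free_subst, nonGlobal_subst, mem_varFinset_up_zero, exists_eq_right]

theorem NonGlobal.free {A : Fm L} {x : ℕ} (h : A.NonGlobal x) : A.Free x := by
  induction A generalizing x with
  | top | bot | neg => exact h.elim
  | rel P ts => exact h
  | and A B iA iB | or A B iA iB | imp A B iA iB => exact h.2.imp iA iB
  | all A iA | ex A iA => exact iA h.2

theorem GN.subst {A : Fm L} (h : A.GN) (σ : ℕ → L.Term ℕ) : (A.subst σ).GN := (gn_subst A σ).2 h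

theorem ST.subst {A : Fm L} (h : A.ST) (σ : ℕ → L.Term ℕ) : (A.subst σ).ST := by
  induction h with
  | top => exact .top
  | gn h => exact .gn (h.subst σ)
  | and _ _ i j => exact .and i j
  | or_gn _ h i => exact .or_gn i (h.subst σ)
  | gn_or h _ i => exact .gn_or (h.subst σ) i
  | imp A B => exact .imp _ _
  | all A => exact .all _

theorem STP.subst {A : Fm L} (h : A.STP) (σ : ℕ → L.Term ℕ) : (A.subst σ).STP := by
  induction h generalizing σ with
  | st h => exact .st (h.subst σ)
  | or _ _ i j => exact .or (i σ) (j σ)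
  | ex _ h i => exact .ex (i _) ((onlyGlobal_subst_up _ σ).2 h)

/-- Only finitely many variables occur free in a formula. -/
theorem exists_free_lt (A : Fm L) : ∃ N, ∀ x, A.Free x → x < N := by
  induction A with
  | top | bot => exact ⟨0, fun _ h => h.elim⟩
  | rel P ts =>
    refine ⟨(Finset.univ.biUnion fun i => (ts i).varFinset).sup id + 1, ?_⟩
    rintro x ⟨i, hi⟩
    have : x ∈ Finset.univ.biUnion fun i => (ts i).varFinset :=
      Finset.mem_biUnion.2 ⟨i, Finset.mem_univ _, hi⟩
    exact Nat.lt_succ_of_le (Finset.le_sup (f := id) this)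
  | and A B iA iB | or A B iA iB | imp A B iA iB =>
    obtain ⟨M, hM⟩ := iA
    obtain ⟨N, hN⟩ := iB
    exact ⟨max M N, fun x h => h.elim (fun h => lt_max_of_lt_left (hM x h))
      fun h => lt_max_of_lt_right (hN x h)⟩
  | neg A iA => exact iA
  | all A iA | ex A iA =>
    obtain ⟨N, hN⟩ := iA
    exact ⟨N, fun x h => by have := hN _ h; omega⟩

end Fm

/-! ### Weakening and substitution in derivations. -/

namespace Deriv

open Fm

variable {L : FirstOrder.Language.{0, 0}} {E : L.Relations 1}

theorem weaken {Γ Δ : Set (Fm L)} {A : Fm L} (h : Deriv E Γ A) (hs : Γ ⊆ Δ) : Deriv E Δ A := by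
  induction h generalizing Δ with
  | hyp h => exact .hyp (hs h)
  | top_intro => exact .top_intro
  | bot_elim _ i => exact .bot_elim (i hs)
  | and_intro _ _ i j => exact .and_intro (i hs) (j hs)
  | and_left _ i => exact .and_left (i hs)
  | and_right _ i => exact .and_right (i hs)
  | or_inl _ i => exact .or_inl (i hs)
  | or_inr _ i => exact .or_inr (i hs)
  | or_elim _ _ _ i j k =>
    exact .or_elim (i hs) (j (Set.insert_subset_insert hs)) (k (Set.insert_subset_insert hs))
  | str_one n _ i => exact .str_one n (i hs)
  | str_two n _ i => exact .str_two n (i hs)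
  | stable h _ i => exact .stable h (i hs)
  | imp_intro _ i => exact .imp_intro (i (Set.insert_subset_insert hs))
  | imp_elim _ _ i j => exact .imp_elim (i hs) (j hs)
  | neg_intro _ i => exact .neg_intro (i hs)
  | neg_elim _ _ i j => exact .neg_elim (i hs) (j hs)
  | dne A => exact .dne A
  | obj => exact .obj
  | all_intro _ i => exact .all_intro (i (Set.image_mono hs))
  | all_elim t _ i => exact .all_elim t (i hs)
  | ex_glo_intro t h _ i => exact .ex_glo_intro t h (i hs)
  | ex_loc_intro t h _ _ i j => exact .ex_loc_intro t h (i hs) (j hs)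
  | ex_glo_elim h _ _ i j =>
    exact .ex_glo_elim h (i hs) (j (Set.insert_subset_insert (Set.image_mono hs)))
  | ex_loc_elim h _ _ i j =>
    exact .ex_loc_elim h (i hs)
      (j (Set.insert_subset_insert (Set.insert_subset_insert (Set.image_mono hs))))

theorem image_lift_subst (Γ : Set (Fm L)) (σ : ℕ → L.Term ℕ) :
    (fun A => Fm.subst A (up σ)) '' (lift '' Γ) = lift '' ((fun A => Fm.subst A σ) '' Γ) := by
  simp only [Set.image_image, lift_subst]

theorem subst {Γ : Set (Fm L)} {A : Fm L} (h : Deriv E Γ A) (σ : ℕ → L.Term ℕ) :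
    Deriv E ((fun A => Fm.subst A σ) '' Γ) (Fm.subst A σ) := by
  induction h generalizing σ with
  | hyp h => exact .hyp ⟨_, h, rfl⟩
  | top_intro => exact .top_intro
  | bot_elim _ i => exact .bot_elim (i σ)
  | and_intro _ _ i j => exact .and_intro (i σ) (j σ)
  | and_left _ i => exact .and_left (i σ)
  | and_right _ i => exact .and_right (i σ)
  | or_inl _ i => exact .or_inl (i σ)
  | or_inr _ i => exact .or_inr (i σ)
  | or_elim _ _ _ i j k =>
    have j := j σ
    have k := k σ
    rw [Set.image_insert_eq] at j k
    exact .or_elim (i σ) j k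
  | str_one n _ i => rw [subst_exi]; exact .str_one n (i σ)
  | str_two n _ i =>
    have i := i σ
    rw [subst_exi] at i ⊢
    exact .str_two (ts := fun i => Term.subst _ σ) n i
  | stable h _ i => exact .stable (h.subst σ) (i σ)
  | imp_intro _ i =>
    have i := i σ
    rw [Set.image_insert_eq] at i
    exact .imp_intro i
  | imp_elim _ _ i j => exact .imp_elim (i σ) (j σ)
  | neg_intro _ i => exact .neg_intro (i σ)
  | neg_elim _ _ i j => exact .neg_elim (i σ) (j σ)
  | dne A => exact .dne _
  | obj =>
    have : (all (neg (neg (exi E (.var 0))))).subst σ = all (neg (neg (exi E (.var 0)))) := by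
      rw [subst_all]
      exact congrArg (fun B => all (neg (neg B))) (subst_exi E (.var 0) (up σ))
    rw [this]
    exact .obj
  | all_intro _ i =>
    have i := i (up σ)
    rw [image_lift_subst] at i
    exact .all_intro i
  | all_elim t _ i =>
    change Deriv E _ (wneg (wneg ((Fm.inst _ t).subst σ)))
    rw [inst_subst]
    exact .all_elim (t.subst σ) (i σ)
  | ex_glo_intro t h _ i =>
    have i := i σ
    rw [inst_subst] at i
    exact .ex_glo_intro (t.subst σ) ((onlyGlobal_subst_up _ σ).2 h) i
  | ex_loc_intro t h _ _ i j =>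
    have i := i σ
    have j := j σ
    rw [inst_subst] at i
    rw [subst_exi] at j
    exact .ex_loc_intro (t.subst σ) (fun h' => h ((onlyGlobal_subst_up _ σ).1 h')) i j
  | ex_glo_elim h _ _ i j =>
    have j := j (up σ)
    rw [Set.image_insert_eq, image_lift_subst, lift_subst] at j
    exact .ex_glo_elim ((onlyGlobal_subst_up _ σ).2 h) (i σ) j
  | ex_loc_elim h _ _ i j =>
    have j := j (up σ)
    rw [Set.image_insert_eq, Set.image_insert_eq, image_lift_subst, lift_subst, subst_exi] at j
    exact .ex_loc_elim (fun h' => h ((onlyGlobal_subst_up _ σ).1 h')) (i σ) j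

end Deriv

/-! # Derived rules -/

namespace Deriv

open Fm

variable {L : FirstOrder.Language.{0, 0}} {E : L.Relations 1} {Γ : Set (Fm L)} {A B C : Fm L}

theorem cut (h : Deriv E Γ B) (h' : Deriv E (insert B Γ) C) : Deriv E Γ C :=
  .or_elim (.or_inl (B := B) h) h' h'

theorem insert_weaken (B : Fm L) (h : Deriv E Γ A) : Deriv E (insert B Γ) A :=
  h.weaken (Set.subset_insert _ _)

theorem wneg_intro (h : Deriv E (insert A Γ) bot) : Deriv E Γ (wneg A) := .imp_intro h.bot_elim

/-- The rule `→E` only yields `∼∼⊥`, but `⊥` is GN and therefore stable. -/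
theorem wneg_elim (h : Deriv E Γ (wneg A)) (h' : Deriv E Γ A) : Deriv E Γ bot :=
  .stable (.st (.gn .bot)) (.imp_elim h h')

theorem neg_of_bot (h : Deriv E (insert A Γ) bot) : Deriv E Γ (neg A) := .neg_intro (wneg_intro h)

theorem wneg_wneg_of_bot (h : Deriv E (insert (neg B) Γ) bot) : Deriv E Γ (wneg (wneg B)) :=
  wneg_intro <| cut (B := neg B) (.neg_intro (.hyp (Set.mem_insert _ _)))
    (h.weaken (Set.insert_subset_insert (Set.subset_insert _ _)))

theorem bot_of_wneg_wneg (h : Deriv E Γ (wneg (wneg B))) (h' : Deriv E (insert B Γ) bot) :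
    Deriv E Γ bot := wneg_elim h (wneg_intro h')

theorem bot_of_neg_neg (h : Deriv E Γ (neg (neg B))) (h' : Deriv E (insert B Γ) bot) :
    Deriv E Γ bot := .neg_elim h (neg_of_bot h')

theorem stable_of_bot (hA : A.STP) (h : Deriv E (insert (neg A) Γ) bot) : Deriv E Γ A :=
  .stable hA (wneg_wneg_of_bot h)

theorem imp_of_bot (h : Deriv E (insert (neg B) (insert A Γ)) bot) : Deriv E Γ (imp A B) :=
  .imp_intro (wneg_wneg_of_bot h)

theorem bot_of_imp (h : Deriv E Γ (imp A B)) (hA : Deriv E Γ A)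
    (h' : Deriv E (insert B Γ) bot) : Deriv E Γ bot :=
  bot_of_wneg_wneg (.imp_elim h hA) h'

theorem all_of_bot (h : Deriv E (insert (neg A) (lift '' Γ)) bot) : Deriv E Γ (all A) :=
  .all_intro (wneg_wneg_of_bot h)

theorem bot_of_all (t : L.Term ℕ) (h : Deriv E Γ (all A))
    (h' : Deriv E (insert (A.inst t) Γ) bot) : Deriv E Γ bot :=
  bot_of_wneg_wneg (.all_elim t h) h'

theorem neg_neg_exi (t : L.Term ℕ) : Deriv E Γ (neg (neg (exi E t))) := by
  have h : Deriv E Γ (wneg (wneg ((neg (neg (exi E (.var 0)))).inst t))) := .all_elim t .obj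
  have e : (neg (neg (exi E (.var 0)))).inst t = neg (neg (exi E t)) :=
    congrArg (fun B => neg (neg B)) (subst_exi E (.var 0) (scons t .var))
  rw [e] at h
  exact .stable (.st (.gn (.neg _))) h

/-- When the goal is `⊥`, the premise `E(t)` of the local rule may be assumed freely, since `¬¬E(t)`
is a theorem. Local and global quantification then behave alike. -/
theorem bot_of_ex_intro (t : L.Term ℕ) (h : Deriv E Γ (A.inst t))
    (h' : Deriv E (insert (ex A) Γ) bot) : Deriv E Γ bot := by
  by_cases hA : A.OnlyGlobal 0
  · exact cut (.ex_glo_intro t hA h) h'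
  · refine bot_of_neg_neg (neg_neg_exi t) (cut (B := ex A) ?_ ?_)
    · exact .ex_loc_intro t hA (h.insert_weaken _) (.hyp (Set.mem_insert _ _))
    · exact h'.weaken (Set.insert_subset_insert (Set.subset_insert _ _))

theorem ex_elim (h : Deriv E Γ (ex A)) (h' : Deriv E (insert A (lift '' Γ)) C.lift) :
    Deriv E Γ C := by
  by_cases hA : A.OnlyGlobal 0
  · exact .ex_glo_elim hA h h'
  · exact .ex_loc_elim hA h (h'.weaken (Set.insert_subset_insert (Set.subset_insert _ _)))

/-- Elimination of an existential hypothesis with an arbitrary fresh variable `y`. -/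
theorem ex_elim_fresh {y : ℕ} (hΓ : ∀ B ∈ Γ, ¬ B.Free y) (hA : ¬ (ex A).Free y) (hC : ¬ C.Free y)
    {Δ : Set (Fm L)} (hΔ : ∀ B ∈ Δ, B = A.inst (.var y) ∨ ¬ A.OnlyGlobal 0 ∧ B = exi E (.var y))
    (h : Deriv E Γ (ex A)) (h' : Deriv E (Δ ∪ Γ) C) : Deriv E Γ C := by
  classical
  -- This renaming sends `y` to the proper variable `0` and shifts the rest: it acts as `lift` on
  -- formulas without `y`, and undoes the instantiation of `A` at `y`.
  let ρ : ℕ → L.Term ℕ := fun x => if x = y then .var 0 else .var (x + 1)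
  have hρ : ∀ B : Fm L, ¬ B.Free y → B.subst ρ = B.lift := fun B hB =>
    subst_congr B fun x hx => if_neg fun e : x = y => hB (e ▸ hx)
  have hAρ : (A.inst (.var y)).subst ρ = A := by
    conv_rhs => rw [← subst_var A]
    rw [inst, subst_subst]
    refine subst_congr A fun x hx => ?_
    cases x with
    | zero => exact if_pos rfl
    | succ x => exact if_neg fun e : x = y => hA (e ▸ hx)
  have hEρ : (exi E (.var y)).subst ρ = exi E (.var 0) := by
    rw [subst_exi]
    exact congrArg (exi E) (if_pos rfl)
  have key := h'.subst ρ
  rw [hρ C hC] at key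
  by_cases hg : A.OnlyGlobal 0
  · refine .ex_glo_elim hg h (key.weaken ?_)
    rintro _ ⟨B, hB | hB, rfl⟩
    · obtain rfl | ⟨h₁, -⟩ := hΔ B hB
      · exact Or.inl hAρ
      · exact absurd hg h₁
    · exact Or.inr ⟨B, hB, (hρ B (hΓ B hB)).symm⟩
  · refine .ex_loc_elim hg h (key.weaken ?_)
    rintro _ ⟨B, hB | hB, rfl⟩
    · obtain rfl | ⟨-, rfl⟩ := hΔ B hB
      · exact Or.inl hAρ
      · exact Or.inr (Or.inl hEρ)
    · exact Or.inr (Or.inr ⟨B, hB, (hρ B (hΓ B hB)).symm⟩)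

/-- The disjunction is stable, so the classical argument by contradiction applies to it. Combined
with primeness, it makes every saturated set decide all negations. -/
theorem em_neg (B : Fm L) : Deriv E Γ (or (neg B) (neg (neg B))) := by
  refine stable_of_bot (.st (.or_gn (.gn (.neg _)) (.neg _))) ?_
  refine .neg_elim (.hyp (Set.mem_insert _ _)) (.or_inr (neg_of_bot ?_))
  exact .neg_elim (A := or (neg B) (neg (neg B))) (.hyp (by simp))
    (.or_inl (.hyp (Set.mem_insert _ _)))

end Deriv

/-! # Countability of the set of formulas -/

namespace Fm

variable {L : FirstOrder.Language.{0, 0}}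

/-- The formulas in which at most `n` operations are nested. -/
def levels (L : FirstOrder.Language.{0, 0}) : ℕ → Set (Fm L)
  | 0 => {top, bot} ∪
      Set.range fun p : (Σ n, L.Relations n × (Fin n → L.Term ℕ)) => rel p.2.1 p.2.2
  | n + 1 => levels L n ∪ (Set.image2 and (levels L n) (levels L n) ∪
      (Set.image2 or (levels L n) (levels L n) ∪ (Set.image2 imp (levels L n) (levels L n) ∪
      (neg '' levels L n ∪ (all '' levels L n ∪ ex '' levels L n)))))

theorem levels_mono : Monotone (levels L) :=
  monotone_nat_of_le_succ fun _ => Set.subset_union_left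

theorem exists_mem_levels (A : Fm L) : ∃ n, A ∈ levels L n := by
  have two : ∀ {A B : Fm L}, (∃ n, A ∈ levels L n) → (∃ n, B ∈ levels L n) →
      ∃ n, A ∈ levels L n ∧ B ∈ levels L n := by
    rintro A B ⟨m, hm⟩ ⟨n, hn⟩
    exact ⟨max m n, levels_mono (le_max_left _ _) hm, levels_mono (le_max_right _ _) hn⟩
  induction A with
  | top => exact ⟨0, by simp [levels]⟩
  | bot => exact ⟨0, by simp [levels]⟩
  | rel P ts => exact ⟨0, Or.inr ⟨⟨_, P, ts⟩, rfl⟩⟩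
  | and A B iA iB =>
    obtain ⟨n, hA, hB⟩ := two iA iB
    exact ⟨n + 1, Or.inr (Or.inl ⟨A, hA, B, hB, rfl⟩)⟩
  | or A B iA iB =>
    obtain ⟨n, hA, hB⟩ := two iA iB
    exact ⟨n + 1, Or.inr (Or.inr (Or.inl ⟨A, hA, B, hB, rfl⟩))⟩
  | imp A B iA iB =>
    obtain ⟨n, hA, hB⟩ := two iA iB
    exact ⟨n + 1, Or.inr (Or.inr (Or.inr (Or.inl ⟨A, hA, B, hB, rfl⟩)))⟩
  | neg A iA =>
    obtain ⟨n, hA⟩ := iA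
    exact ⟨n + 1, Or.inr (Or.inr (Or.inr (Or.inr (Or.inl ⟨A, hA, rfl⟩))))⟩
  | all A iA =>
    obtain ⟨n, hA⟩ := iA
    exact ⟨n + 1, Or.inr (Or.inr (Or.inr (Or.inr (Or.inr (Or.inl ⟨A, hA, rfl⟩)))))⟩
  | ex A iA =>
    obtain ⟨n, hA⟩ := iA
    exact ⟨n + 1, Or.inr (Or.inr (Or.inr (Or.inr (Or.inr (Or.inr ⟨A, hA, rfl⟩)))))⟩

theorem countable_functions [Countable L.Symbols] : Countable (Σ n, L.Functions n) :=
  (Sum.inl_injective : Function.Injective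
    (Sum.inl : (Σ n, L.Functions n) → L.Symbols)).countable

theorem countable_relations [Countable L.Symbols] : Countable (Σ n, L.Relations n) :=
  (Sum.inr_injective : Function.Injective
    (Sum.inr : (Σ n, L.Relations n) → L.Symbols)).countable

theorem levels_countable [Countable L.Symbols] (n : ℕ) : (levels L n).Countable := by
  have := countable_functions (L := L)
  have := countable_relations (L := L)
  have (n : ℕ) : Countable (L.Relations n) :=
    (sigma_mk_injective : Function.Injective (Sigma.mk n : L.Relations n → _)).countable
  induction n with
  | zero => exact ((Set.countable_singleton _).insert _).union (Set.countable_range _)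
  | succ n ih =>
    exact ih.union ((ih.image2 ih _).union ((ih.image2 ih _).union ((ih.image2 ih _).union
      ((ih.image _).union ((ih.image _).union (ih.image _))))))

instance countable [Countable L.Symbols] : Countable (Fm L) := by
  rw [← Set.countable_univ_iff]
  exact (Set.countable_iUnion levels_countable).mono fun A _ =>
    Set.mem_iUnion.2 (exists_mem_levels A)

end Fm

/-! # Saturated sets -/

open Fm

/-- Consistent prime sets of formulas with witnesses for existential formulas. -/
structure Saturated {L : FirstOrder.Language.{0, 0}} (E : L.Relations 1) (Δ : Set (Fm L)) :
    Prop where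
  closed : ∀ {A B C : Fm L}, A ∈ Δ → B ∈ Δ → Deriv E {A, B} C → C ∈ Δ
  top_mem : top ∈ Δ
  bot_not_mem : bot ∉ Δ
  prime : ∀ {A B : Fm L}, or A B ∈ Δ → A ∈ Δ ∨ B ∈ Δ
  witness : ∀ {A : Fm L}, ex A ∈ Δ →
    ∃ t, A.inst t ∈ Δ ∧ (¬ A.OnlyGlobal 0 → exi E t ∈ Δ)

/-! ### Lindenbaum–Henkin extension. -/

section Extension

variable {L : FirstOrder.Language.{0, 0}} {E : L.Relations 1}

theorem exists_fresh {Γ : Set (Fm L)} (h : Γ.Finite) : ∃ y, ∀ B ∈ Γ, ¬ B.Free y := by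
  choose N hN using fun B : Fm L => B.exists_free_lt
  obtain ⟨M, hM⟩ := (h.image N).bddAbove
  exact ⟨M, fun B hB hf => absurd (hN B M hf) (not_lt.2 (hM ⟨B, hB, rfl⟩))⟩

/-- Finiteness of each stage leaves an unused variable, which serves as the Henkin witness, so no
new constants are needed. A formula is refused only if it would make `C` derivable. -/
theorem exists_extension {C : Fm L} {Γ : Set (Fm L)} (hΓ : Γ.Finite)
    (hn : ¬ Deriv E Γ C) (B : Fm L) :
    ∃ Γ' : Set (Fm L), (Γ'.Finite ∧ ¬ Deriv E Γ' C) ∧ Γ ⊆ Γ' ∧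
      (Deriv E (insert B Γ) C ∨ B ∈ Γ' ∧ ∀ A, B = ex A →
        ∃ t, A.inst t ∈ Γ' ∧ (¬ A.OnlyGlobal 0 → exi E t ∈ Γ')) := by
  by_cases hB : Deriv E (insert B Γ) C
  · exact ⟨Γ, ⟨hΓ, hn⟩, subset_rfl, Or.inl hB⟩
  by_cases he : ∃ A, B = ex A
  · obtain ⟨A, rfl⟩ := he
    obtain ⟨y, hy⟩ := exists_fresh ((hΓ.insert (ex A)).insert C)
    let Δ : Set (Fm L) :=
      {B | B = A.inst (.var y) ∨ ¬ A.OnlyGlobal 0 ∧ B = exi E (.var y)}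
    have hΔ : Δ.Finite := (Set.toFinite {A.inst (.var y), exi E (.var y)}).subset
      fun B hB => hB.imp id And.right
    refine ⟨Δ ∪ insert (ex A) Γ, ⟨hΔ.union (hΓ.insert _), fun h => hB ?_⟩,
      fun _ h => Or.inr (Or.inr h), Or.inr ⟨Or.inr (Or.inl rfl), ?_⟩⟩
    · exact Deriv.ex_elim_fresh (fun B h => hy B (Or.inr h)) (hy _ (Or.inr (Or.inl rfl)))
        (hy _ (Or.inl rfl)) (fun _ h => h) (.hyp (Or.inl rfl)) h
    · rintro _ ⟨⟩
      exact ⟨.var y, Or.inl (Or.inl rfl), fun h => Or.inl (Or.inr ⟨h, rfl⟩)⟩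
  · exact ⟨insert B Γ, ⟨hΓ.insert _, hB⟩, Set.subset_insert _ _,
      Or.inr ⟨Or.inl rfl, fun A e => absurd ⟨A, e⟩ he⟩⟩

theorem exists_saturated [Countable L.Symbols] {C : Fm L} {Γ : Set (Fm L)} (hΓ : Γ.Finite)
    (hn : ¬ Deriv E Γ C) : ∃ Δ : Set (Fm L), Saturated E Δ ∧ Γ ⊆ Δ ∧ C ∉ Δ := by
  have : Nonempty (Fm L) := ⟨top⟩
  obtain ⟨f, hf⟩ := exists_surjective_nat (Fm L)
  choose next hnext using fun (n : ℕ) (Γ : {Γ : Set (Fm L) // Γ.Finite ∧ ¬ Deriv E Γ C}) =>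
    exists_extension Γ.2.1 Γ.2.2 (f n)
  let G : ℕ → {Γ : Set (Fm L) // Γ.Finite ∧ ¬ Deriv E Γ C} := fun n =>
    Nat.rec ⟨Γ, hΓ, hn⟩ (fun n Γ => ⟨next n Γ, (hnext n Γ).1⟩) n
  have mono : Monotone fun n => (G n).1 :=
    monotone_nat_of_le_succ fun n => (hnext n (G n)).2.1
  have step := fun n => (hnext n (G n)).2.2
  have join : ∀ {A B : Fm L}, (∃ n, Deriv E (G n).1 A) → (∃ n, Deriv E (G n).1 B) →
      ∃ n, Deriv E (G n).1 A ∧ Deriv E (G n).1 B := by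
    rintro A B ⟨m, hm⟩ ⟨n, hn⟩
    exact ⟨max m n, hm.weaken (mono (le_max_left _ _)), hn.weaken (mono (le_max_right _ _))⟩
  -- The saturated set consists of everything derivable at some stage; `C` is derivable at none.
  refine ⟨{A | ∃ n, Deriv E (G n).1 A}, ⟨?_, ⟨0, .top_intro⟩, ?_, ?_, ?_⟩, fun A hA => ⟨0, .hyp hA⟩,
    fun ⟨n, h⟩ => (G n).2.2 h⟩
  · intro A B C hA hB h
    obtain ⟨n, hA, hB⟩ := join hA hB
    refine ⟨n, .cut hA (.cut (hB.insert_weaken A) (h.weaken ?_))⟩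
    rintro _ (rfl | rfl)
    · exact Or.inr (Or.inl rfl)
    · exact Or.inl rfl
  · rintro ⟨n, h⟩
    exact (G n).2.2 h.bot_elim
  · rintro A B ⟨k, h⟩
    obtain ⟨m, rfl⟩ := hf A
    obtain ⟨n, rfl⟩ := hf B
    obtain hm | hm := step m
    · obtain hn | hn := step n
      -- Both disjuncts were refused, so each yields `C`; a stage that also derives the disjunction
      -- would derive `C`.
      · refine ((G (max k (max m n))).2.2 ?_).elim
        refine .or_elim (h.weaken (mono (le_max_left _ _)))
          (hm.weaken (Set.insert_subset_insert (mono ?_)))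
          (hn.weaken (Set.insert_subset_insert (mono ?_)))
        · exact (le_max_left _ _).trans (le_max_right _ _)
        · exact (le_max_right _ _).trans (le_max_right _ _)
      · exact Or.inr ⟨n + 1, .hyp hn.1⟩
    · exact Or.inl ⟨m + 1, .hyp hm.1⟩
  · rintro A ⟨k, h⟩
    obtain ⟨n, hn⟩ := hf (ex A)
    obtain h' | ⟨-, h'⟩ := step n
    · rw [hn] at h'
      refine ((G (max k n)).2.2 ?_).elim
      -- A refused formula cannot become derivable later: a cut would derive `C`.
      exact .cut (h.weaken (mono (le_max_left _ _)))
        (h'.weaken (Set.insert_subset_insert (mono (le_max_right _ _))))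
    · obtain ⟨t, ht, ht'⟩ := h' A hn
      exact ⟨t, ⟨n + 1, .hyp ht⟩, fun hg => ⟨n + 1, .hyp (ht' hg)⟩⟩

end Extension

/-! ### Saturated sets, and classical behaviour under double negation. -/

namespace Saturated

variable {L : FirstOrder.Language.{0, 0}} {E : L.Relations 1} {Δ : Set (Fm L)} {A B C : Fm L}

theorem closed_one (h : Saturated E Δ) (hA : A ∈ Δ) (hd : Deriv E {A} C) : C ∈ Δ :=
  h.closed hA hA (hd.weaken (by simp))

theorem closed_nil (h : Saturated E Δ) (hd : Deriv E ∅ C) : C ∈ Δ :=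
  h.closed_one h.top_mem (hd.weaken (Set.empty_subset _))

theorem inconsistent (h : Saturated E Δ) (hA : A ∈ Δ) (hB : B ∈ Δ) (hd : Deriv E {A, B} bot) :
    False := h.bot_not_mem (h.closed hA hB hd)

theorem em (h : Saturated E Δ) (B : Fm L) : neg B ∈ Δ ∨ neg (neg B) ∈ Δ :=
  h.prime (h.closed_nil (.em_neg B))

theorem neg_neg_mem (h : Saturated E Δ) (hA : A ∈ Δ) : neg (neg A) ∈ Δ :=
  h.closed_one hA (.neg_of_bot (.neg_elim (.hyp (Or.inl rfl)) (.hyp (Or.inr rfl))))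

theorem stable_mem (h : Saturated E Δ) (hA : A.STP) : neg (neg A) ∈ Δ ↔ A ∈ Δ :=
  ⟨fun hn => h.closed_one hn (.stable_of_bot hA
    (.neg_elim (.hyp (Or.inr rfl)) (.hyp (Or.inl rfl)))), h.neg_neg_mem⟩

theorem neg_mem (h : Saturated E Δ) : neg A ∈ Δ ↔ neg (neg A) ∉ Δ :=
  ⟨fun hA hn => h.inconsistent hn hA (.neg_elim (.hyp (Or.inl rfl)) (.hyp (Or.inr rfl))),
    (h.em A).resolve_right⟩

theorem neg_neg_bot (h : Saturated E Δ) : neg (neg (bot : Fm L)) ∉ Δ := fun hn =>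
  h.bot_not_mem ((h.stable_mem (.st (.gn .bot))).1 hn)

theorem neg_neg_and (h : Saturated E Δ) :
    neg (neg (and A B)) ∈ Δ ↔ neg (neg A) ∈ Δ ∧ neg (neg B) ∈ Δ := by
  refine ⟨fun hn => ⟨?_, ?_⟩, fun ⟨hA, hB⟩ => ?_⟩
  · exact h.closed_one hn (.neg_of_bot (.bot_of_neg_neg (.hyp (Or.inr rfl))
      (.neg_elim (.hyp (Or.inr (Or.inl rfl))) (.and_left (.hyp (Or.inl rfl))))))
  · exact h.closed_one hn (.neg_of_bot (.bot_of_neg_neg (.hyp (Or.inr rfl))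
      (.neg_elim (.hyp (Or.inr (Or.inl rfl))) (.and_right (.hyp (Or.inl rfl))))))
  · refine h.closed hA hB (.neg_of_bot (.bot_of_neg_neg (B := A) (.hyp (by simp))
      (.bot_of_neg_neg (B := B) (.hyp (by simp)) ?_)))
    exact .neg_elim (A := and A B) (.hyp (by simp))
      (.and_intro (.hyp (by simp)) (.hyp (by simp)))

theorem and_mem (h : Saturated E Δ) : and A B ∈ Δ ↔ A ∈ Δ ∧ B ∈ Δ :=
  ⟨fun hn => ⟨h.closed_one hn (.and_left (.hyp rfl)), h.closed_one hn (.and_right (.hyp rfl))⟩,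
    fun ⟨hA, hB⟩ => h.closed hA hB (.and_intro (.hyp (Or.inl rfl)) (.hyp (Or.inr rfl)))⟩

theorem or_mem (h : Saturated E Δ) : or A B ∈ Δ ↔ A ∈ Δ ∨ B ∈ Δ :=
  ⟨h.prime, fun hn => hn.elim (fun hA => h.closed_one hA (.or_inl (.hyp rfl)))
    fun hB => h.closed_one hB (.or_inr (.hyp rfl))⟩

/-- `¬¬A ∨ ¬¬B` is stable, hence derivable from `¬¬(A ∨ B)`; primeness then splits it. -/
theorem neg_neg_or (h : Saturated E Δ) :
    neg (neg (or A B)) ∈ Δ ↔ neg (neg A) ∈ Δ ∨ neg (neg B) ∈ Δ := by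
  refine ⟨fun hn => ?_, fun hn => ?_⟩
  · refine h.prime (h.closed_one hn (.stable_of_bot
      (.st (.or_gn (.gn (.neg _)) (.neg _))) (.bot_of_neg_neg (B := or A B) (.hyp (by simp)) ?_)))
    refine .or_elim (.hyp (Or.inl rfl)) ?_ ?_
    · refine .neg_elim (A := or (neg (neg A)) (neg (neg B))) (.hyp (by simp))
        (.or_inl (.neg_of_bot ?_))
      exact .neg_elim (A := A) (.hyp (by simp)) (.hyp (by simp))
    · refine .neg_elim (A := or (neg (neg A)) (neg (neg B))) (.hyp (by simp))
        (.or_inr (.neg_of_bot ?_))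
      exact .neg_elim (A := B) (.hyp (by simp)) (.hyp (by simp))
  · obtain hn | hn := hn
    · exact h.closed_one hn (.neg_of_bot (.bot_of_neg_neg (B := A) (.hyp (by simp))
        (.neg_elim (A := or A B) (.hyp (by simp)) (.or_inl (.hyp (by simp))))))
    · exact h.closed_one hn (.neg_of_bot (.bot_of_neg_neg (B := B) (.hyp (by simp))
        (.neg_elim (A := or A B) (.hyp (by simp)) (.or_inr (.hyp (by simp))))))

theorem imp_mem (h : Saturated E Δ) :
    imp A B ∈ Δ ↔ (neg (neg A) ∈ Δ → neg (neg B) ∈ Δ) := by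
  refine ⟨fun hn hA => ?_, fun hn => ?_⟩
  · exact h.closed hn hA (.neg_of_bot (.bot_of_neg_neg (B := A) (.hyp (by simp))
      (.bot_of_imp (A := A) (B := B) (.hyp (by simp)) (.hyp (by simp))
        (.neg_elim (A := B) (.hyp (by simp)) (.hyp (by simp))))))
  · obtain hA | hA := h.em A
    · exact h.closed_one hA (.imp_of_bot (.neg_elim (A := A) (.hyp (by simp)) (.hyp (by simp))))
    · exact h.closed_one (hn hA)
        (.imp_of_bot (.neg_elim (A := neg B) (.hyp (by simp)) (.hyp (by simp))))

theorem all_mem (h : Saturated E Δ) : all A ∈ Δ ↔ ∀ t, neg (neg (A.inst t)) ∈ Δ := by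
  refine ⟨fun hn t => ?_, fun hn => ?_⟩
  · exact h.closed_one hn (.neg_of_bot (.bot_of_all (A := A) t (.hyp (by simp))
      (.neg_elim (A := A.inst t) (.hyp (by simp)) (.hyp (by simp)))))
  -- `∃x¬A` is GN, so it is decided and stable. If refuted, it yields `∀xA` by contradiction;
  -- otherwise its witness contradicts the hypothesis.
  · obtain he | he := h.em (ex (neg A))
    · refine h.closed_one he (.all_of_bot ?_)
      refine .bot_of_ex_intro (A := (neg A).subst (up fun n => .var (n + 1))) (.var 0) ?_ ?_
      · rw [lift_body_inst]
        exact .hyp (Or.inl rfl)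
      · refine .neg_elim (A := (ex (neg A)).lift) (.hyp ?_) (.hyp (Or.inl rfl))
        exact Or.inr (Or.inr ⟨_, rfl, rfl⟩)
    · obtain ⟨t, ht, -⟩ := h.witness ((h.stable_mem (.st (.gn (.ex (.neg A))))).1 he)
      exact (h.inconsistent (hn t) ht (.neg_elim (.hyp (Or.inl rfl)) (.hyp (Or.inr rfl)))).elim

theorem neg_neg_ex (h : Saturated E Δ) :
    neg (neg (ex A)) ∈ Δ ↔ ∃ t, neg (neg (A.inst t)) ∈ Δ := by
  refine ⟨fun hn => ?_, fun ⟨t, ht⟩ => ?_⟩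
  · by_contra! hc
    have ha : all (neg A) ∈ Δ := h.all_mem.2 fun t => h.neg_neg_mem (h.neg_mem.2 (hc t))
    refine h.inconsistent hn ha (.bot_of_neg_neg (B := ex A) (.hyp (by simp))
      (.ex_elim (.hyp (Or.inl rfl)) ?_))
    refine .bot_of_all (A := (neg A).subst (up fun n => .var (n + 1))) (.var 0)
      (.hyp (Or.inr ⟨all (neg A), by simp, rfl⟩)) ?_
    rw [lift_body_inst]
    exact .neg_elim (A := A) (.hyp (by simp)) (.hyp (by simp))
  · exact h.closed_one ht (.neg_of_bot (.bot_of_neg_neg (B := A.inst t) (.hyp (by simp))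
      (.bot_of_ex_intro t (.hyp (Or.inl rfl)) (.neg_elim (A := ex A) (.hyp (by simp))
        (.hyp (by simp))))))

theorem ex_mem (h : Saturated E Δ) :
    ex A ∈ Δ ↔ ∃ t, A.inst t ∈ Δ ∧ (¬ A.OnlyGlobal 0 → exi E t ∈ Δ) := by
  refine ⟨h.witness, fun ⟨t, ht, hE⟩ => ?_⟩
  by_cases hA : A.OnlyGlobal 0
  · exact h.closed_one ht (.ex_glo_intro t hA (.hyp rfl))
  · exact h.closed ht (hE hA) (.ex_loc_intro t hA (.hyp (Or.inl rfl)) (.hyp (Or.inr rfl)))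

theorem neg_neg_exi (h : Saturated E Δ) (t : L.Term ℕ) : neg (neg (exi E t)) ∈ Δ :=
  h.closed_nil (.neg_neg_exi t)

/-- In the term structure, `interp .func` flattens a term whose names are themselves terms; STR₂
descends through it. -/
theorem exi_subterm (h : Saturated E Δ) (t : L.Term (L.Term ℕ))
    (ht : exi E (interp .func t) ∈ Δ) : ∀ s ∈ subterms t, exi E (interp .func s) ∈ Δ := by
  induction t with
  | var x => rintro s rfl; exact ht
  | func f ts ih =>
    rintro s (rfl | hs)
    · exact ht
    · obtain ⟨i, hi⟩ := Set.mem_iUnion.1 hs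
      exact ih i (h.closed_one ht (.str_two (f := f) (ts := fun i => interp .func (ts i)) i
        (.hyp rfl))) s hi

end Saturated

/-! # The canonical model -/

section Canonical

variable {L : FirstOrder.Language.{0, 0}} {E : L.Relations 1} {Δ : Set (Fm L)}

/-- The canonical model of a saturated set `Δ`: its root verifies the atoms in `Δ` with predicates
in `S 0`, and a later node `k` all atoms with predicates in `S k` whose double negation is
in `Δ`. -/
def canonicalModel (hΔ : Saturated E Δ) (S : ℕ → Set (Σ n, L.Relations n)) (hS : Monotone S)
    (hfin : ∀ k, (S k).Finite) (hE : ⟨1, E⟩ ∈ S 0) : Model L E where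
  K := ℕ
  rooted := ⟨0, Nat.zero_le⟩
  tree := fun _ _ _ _ _ _ => le_total _ _
  height := Set.finite_Iic
  branching := fun _ => Set.to_countable _
  D := L.Term ℕ
  nonempty := ⟨.var 0⟩
  fn := .func
  v := fun k {n} P =>
    {ds | ⟨n, P⟩ ∈ S k ∧ (rel P ds ∈ Δ ∨ 1 ≤ k ∧ neg (neg (rel P ds)) ∈ Δ)}
  mono := fun hk _ _ _ ⟨hP, h⟩ => ⟨hS hk hP, h.imp_right fun h => ⟨h.1.trans hk, h.2⟩⟩
  strict := by
    rintro k n P c ⟨-, h⟩ i c' hc'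
    -- Atoms in `Δ` need the STR rules; atoms verified through `¬¬` occur only after the root, where
    -- every object exists.
    refine ⟨hS k.zero_le hE, h.imp (fun h => ?_) fun h => ⟨h.1, hΔ.neg_neg_exi _⟩⟩
    exact hΔ.exi_subterm (c i) (hΔ.closed_one h (.str_one
      (ts := fun i => interp .func (c i)) i (.hyp rfl))) c' hc'
  finite_verification := fun k => (hfin k).subset fun _ ⟨_, h, _⟩ => h

end Canonical

/-- `A.PredsIn S`: all predicates in `A` belong to `S`. -/
def Fm.PredsIn {L : FirstOrder.Language.{0, 0}} (S : Set (Σ n, L.Relations n)) : Fm L → Prop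
  | .top => True
  | .bot => True
  | .rel P _ => ⟨_, P⟩ ∈ S
  | .and A B => A.PredsIn S ∧ B.PredsIn S
  | .or A B => A.PredsIn S ∧ B.PredsIn S
  | .imp A B => A.PredsIn S ∧ B.PredsIn S
  | .neg A => A.PredsIn S
  | .all A => A.PredsIn S
  | .ex A => A.PredsIn S

theorem Fm.PredsIn.mono {L : FirstOrder.Language.{0, 0}} {S T : Set (Σ n, L.Relations n)}
    (hST : S ⊆ T) {A : Fm L} (h : A.PredsIn S) : A.PredsIn T := by
  induction A with
  | top | bot => trivial
  | rel P ts => exact hST h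
  | and A B iA iB | or A B iA iB | imp A B iA iB => exact ⟨iA h.1, iB h.2⟩
  | neg A iA | all A iA | ex A iA => exact iA h

theorem Fm.exists_finite_predsIn {L : FirstOrder.Language.{0, 0}} (A : Fm L) :
    ∃ S : Set (Σ n, L.Relations n), S.Finite ∧ A.PredsIn S := by
  induction A with
  | top | bot => exact ⟨∅, Set.finite_empty, trivial⟩
  | rel P ts => exact ⟨{⟨_, P⟩}, Set.finite_singleton _, Set.mem_singleton _⟩
  | and A B iA iB | or A B iA iB | imp A B iA iB =>
    obtain ⟨S, hS, hA⟩ := iA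
    obtain ⟨T, hT, hB⟩ := iB
    exact ⟨S ∪ T, hS.union hT, hA.mono Set.subset_union_left, hB.mono Set.subset_union_right⟩
  | neg A iA | all A iA | ex A iA => exact iA

theorem Model.Forces.mono {L : FirstOrder.Language.{0, 0}} {E : L.Relations 1} {W : Model L E}
    {A : Fm L} {k k' : W.K} (hk : k ≤ k') {e : ℕ → W.D} (h : W.Forces A k e) :
    W.Forces A k' e := by
  induction A generalizing e with
  | top => trivial
  | bot => exact h
  | rel P ts => exact W.mono hk P h
  | and A B iA iB => exact ⟨iA h.1, iB h.2⟩
  | or A B iA iB => exact h.imp iA iB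
  | imp A B iA iB => exact fun l hl => h l (hk.trans hl)
  | neg A iA => exact h
  | all A iA =>
    exact ⟨fun hA d l hl => h.1 hA d l (hk.trans hl), fun hA d l hl => h.2 hA d l (hk.trans hl)⟩
  | ex A iA =>
    exact ⟨fun hA => (h.1 hA).imp fun _ => iA,
      fun hA => (h.2 hA).imp fun _ hd => ⟨W.mono hk E hd.1, iA hd.2⟩⟩

/-! ### The two truth lemmas. -/

section Truth

variable {L : FirstOrder.Language.{0, 0}} {E : L.Relations 1} {Δ : Set (Fm L)}
  (hΔ : Saturated E Δ) (S : ℕ → Set (Σ n, L.Relations n)) (hS : Monotone S)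
  (hfin : ∀ k, (S k).Finite) (hE : ⟨1, E⟩ ∈ S 0)

theorem canonicalModel_interp (t : L.Term ℕ) (e : ℕ → L.Term ℕ) :
    interp (canonicalModel hΔ S hS hfin hE).fn (t.relabel e) = t.subst e := by
  induction t with
  | var => rfl
  | func f ts ih => exact congrArg (Term.func f) (funext ih)

theorem canonicalModel_exi (d : L.Term ℕ) {k : ℕ} (hk : 1 ≤ k) :
    ![d] ∈ (canonicalModel hΔ S hS hfin hE).v k E :=
  ⟨hS k.zero_le hE, Or.inr ⟨hk, hΔ.neg_neg_exi d⟩⟩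

theorem canonicalModel_forces_rel {n : ℕ} (P : L.Relations n) (ts : Fin n → L.Term ℕ) (k : ℕ)
    (e : ℕ → L.Term ℕ) :
    (canonicalModel hΔ S hS hfin hE).Forces (rel P ts) k e ↔
      ⟨n, P⟩ ∈ S k ∧ ((rel P ts).subst e ∈ Δ ∨ 1 ≤ k ∧ neg (neg ((rel P ts).subst e)) ∈ Δ) := by
  simp only [Model.Forces, canonicalModel_interp]
  exact Iff.rfl

/-- Both directions go in one induction, since the cases `→` and `¬` use each for the antecedent. No
bound on the predicates is needed, as every predicate is eventually released. -/
theorem canonicalModel_assertible (hcov : ∀ P, ∃ k, P ∈ S k) (A : Fm L) (e : ℕ → L.Term ℕ) :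
    (neg (neg (A.subst e)) ∈ Δ → (canonicalModel hΔ S hS hfin hE).PrevalentIn A e) ∧
      ((canonicalModel hΔ S hS hfin hE).Assertible A e → neg (neg (A.subst e)) ∈ Δ) := by
  induction A generalizing e with
  | top => exact ⟨fun _ k => ⟨k, le_rfl, trivial⟩, fun _ => hΔ.neg_neg_mem hΔ.top_mem⟩
  | bot => exact ⟨fun h => (hΔ.neg_neg_bot h).elim, fun ⟨_, h⟩ => h.elim⟩
  | rel P ts =>
    refine ⟨fun h (k : ℕ) => ?_, fun ⟨k, h⟩ => ?_⟩
    · obtain ⟨l, hl⟩ := hcov ⟨_, P⟩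
      refine ⟨(max k (max l 1) : ℕ), le_max_left k _,
        (canonicalModel_forces_rel hΔ S hS hfin hE P ts _ e).2 ⟨hS ?_ hl, Or.inr ⟨?_, h⟩⟩⟩
      · exact (le_max_left _ _).trans (le_max_right _ _)
      · exact (le_max_right _ _).trans (le_max_right _ _)
    · obtain ⟨-, h | h⟩ := (canonicalModel_forces_rel hΔ S hS hfin hE P ts _ e).1 h
      · exact hΔ.neg_neg_mem h
      · exact h.2
  | and A B iA iB =>
    refine ⟨fun h k => ?_, fun ⟨k, h⟩ => ?_⟩
    · obtain ⟨hA, hB⟩ := hΔ.neg_neg_and.1 h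
      obtain ⟨l, hl, hA⟩ := (iA e).1 hA k
      obtain ⟨m, hm, hB⟩ := (iB e).1 hB l
      exact ⟨m, hl.trans hm, hA.mono hm, hB⟩
    · exact hΔ.neg_neg_and.2 ⟨(iA e).2 ⟨k, h.1⟩, (iB e).2 ⟨k, h.2⟩⟩
  | or A B iA iB =>
    refine ⟨fun h k => ?_, fun ⟨k, h⟩ => ?_⟩
    · obtain h | h := hΔ.neg_neg_or.1 h
      · exact ((iA e).1 h k).imp fun _ h => ⟨h.1, Or.inl h.2⟩
      · exact ((iB e).1 h k).imp fun _ h => ⟨h.1, Or.inr h.2⟩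
    · exact hΔ.neg_neg_or.2 (h.imp (fun h => (iA e).2 ⟨k, h⟩) fun h => (iB e).2 ⟨k, h⟩)
  | imp A B iA iB =>
    have hi : neg (neg ((imp A B).subst e)) ∈ Δ ↔ _ :=
      (hΔ.stable_mem (.st (.imp _ _))).trans hΔ.imp_mem
    rw [hi]
    refine ⟨fun h k => ⟨k, le_rfl, fun l _ hA => (iB e).1 (h ((iA e).2 ⟨l, hA⟩)) l⟩,
      fun ⟨k, h⟩ hA => ?_⟩
    obtain ⟨l, hl, hA⟩ := (iA e).1 hA k
    obtain ⟨m, -, hB⟩ := h l hl hA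
    exact (iB e).2 ⟨m, hB⟩
  | neg A iA =>
    have hi : neg (neg ((neg A).subst e)) ∈ Δ ↔ _ :=
      (hΔ.stable_mem (.st (.gn (.neg _)))).trans hΔ.neg_mem
    rw [hi]
    refine ⟨fun h k => ⟨k, le_rfl, fun l hA => h ((iA e).2 ⟨l, hA⟩)⟩, fun ⟨k, h⟩ hA => ?_⟩
    obtain ⟨l, -, hA⟩ := (iA e).1 hA k
    exact h l hA
  | all A iA =>
    have hi : neg (neg ((all A).subst e)) ∈ Δ ↔ ∀ t, neg (neg (A.subst (scons t e))) ∈ Δ := by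
      simp only [subst_scons]
      exact (hΔ.stable_mem (.st (.all _))).trans hΔ.all_mem
    rw [hi]
    refine ⟨fun h k => ⟨k, le_rfl, fun _ d l _ => (iA _).1 (h d) l,
      fun _ d l _ _ => (iA _).1 (h d) l⟩, fun ⟨k, h⟩ d => ?_⟩
    by_cases hA : A.OnlyGlobal 0
    · obtain ⟨l, -, hl⟩ := h.1 hA d k le_rfl
      exact (iA _).2 ⟨l, hl⟩
    · let k₀ : ℕ := k
      -- Past the root every object exists, so the local guard is met.
      obtain ⟨l, -, hl⟩ := h.2 hA d (max k₀ 1 : ℕ) (le_max_left k₀ 1)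
        (canonicalModel_exi hΔ S hS hfin hE d (le_max_right _ _))
      exact (iA _).2 ⟨l, hl⟩
  | ex A iA =>
    have hi : neg (neg ((ex A).subst e)) ∈ Δ ↔ ∃ t, neg (neg (A.subst (scons t e))) ∈ Δ := by
      simp only [subst_scons]
      exact hΔ.neg_neg_ex
    rw [hi]
    refine ⟨fun ⟨d, hd⟩ (k : ℕ) => ?_, fun ⟨k, h⟩ => ?_⟩
    · obtain ⟨l, hl, hA⟩ := (iA _).1 hd (max k 1 : ℕ)
      exact ⟨l, (le_max_left k 1).trans hl, fun _ => ⟨d, hA⟩, fun _ => ⟨d,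
        canonicalModel_exi hΔ S hS hfin hE d ((le_max_right k 1).trans hl), hA⟩⟩
    · by_cases hA : A.OnlyGlobal 0
      · obtain ⟨d, hd⟩ := h.1 hA
        exact ⟨d, (iA _).2 ⟨k, hd⟩⟩
      · obtain ⟨d, -, hd⟩ := h.2 hA
        exact ⟨d, (iA _).2 ⟨k, hd⟩⟩

theorem canonicalModel_isPrevalent (hcov : ∀ P, ∃ k, P ∈ S k) :
    (canonicalModel hΔ S hS hfin hE).IsPrevalent :=
  ⟨fun A e h => (canonicalModel_assertible hΔ S hS hfin hE hcov A e).1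
    ((canonicalModel_assertible hΔ S hS hfin hE hcov A e).2 h),
    fun d (k : ℕ) => ⟨(max k 1 : ℕ), le_max_left k 1,
      canonicalModel_exi hΔ S hS hfin hE d (le_max_right _ _)⟩⟩

/-- The bound on predicates is needed because an atom of `Δ` outside `S 0` is not yet verified at
the root. -/
theorem canonicalModel_forces_root (hcov : ∀ P, ∃ k, P ∈ S k) (A : Fm L) (hA : A.PredsIn (S 0))
    (e : ℕ → L.Term ℕ) :
    (canonicalModel hΔ S hS hfin hE).Forces A (0 : ℕ) e ↔ A.subst e ∈ Δ := by
  have stable : ∀ (A : Fm L) (e : ℕ → L.Term ℕ), (A.subst e).STP →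
      (canonicalModel hΔ S hS hfin hE).Forces A (0 : ℕ) e → A.subst e ∈ Δ := fun A e hs h =>
    (hΔ.stable_mem hs).1 ((canonicalModel_assertible hΔ S hS hfin hE hcov A e).2 ⟨_, h⟩)
  have prev := fun (A : Fm L) (e : ℕ → L.Term ℕ) (h : neg (neg (A.subst e)) ∈ Δ) =>
    (canonicalModel_assertible hΔ S hS hfin hE hcov A e).1 h
  have val := fun (A : Fm L) (e : ℕ → L.Term ℕ) =>
    (canonicalModel_assertible hΔ S hS hfin hE hcov A e).2
  induction A generalizing e with
  | top => exact ⟨fun _ => hΔ.top_mem, fun _ => trivial⟩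
  | bot => exact ⟨fun h => h.elim, fun h => hΔ.bot_not_mem h⟩
  | rel P ts =>
    rw [canonicalModel_forces_rel]
    exact ⟨fun h => h.2.resolve_right fun h => absurd h.1 (by decide), fun h => ⟨hA, Or.inl h⟩⟩
  | and A B iA iB =>
    exact (and_congr (iA hA.1 e) (iB hA.2 e)).trans hΔ.and_mem.symm
  | or A B iA iB =>
    exact (or_congr (iA hA.1 e) (iB hA.2 e)).trans hΔ.or_mem.symm
  | imp A B iA iB =>
    refine ⟨stable _ _ (.st (.imp _ _)), fun h l _ hl => ?_⟩
    exact prev B e (hΔ.imp_mem.1 h (val A e ⟨l, hl⟩)) l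
  | neg A iA =>
    refine ⟨stable _ _ (.st (.gn (.neg _))), fun h l hl => ?_⟩
    exact hΔ.neg_mem.1 h (val A e ⟨l, hl⟩)
  | all A iA =>
    refine ⟨stable _ _ (.st (.all _)), fun h => ?_⟩
    have h : ∀ d, neg (neg (A.subst (scons d e))) ∈ Δ := fun d => by
      rw [subst_scons]
      exact hΔ.all_mem.1 h d
    exact ⟨fun _ d l _ => prev A _ (h d) l, fun _ d l _ _ => prev A _ (h d) l⟩
  | ex A iA =>
    have hi : (ex A).subst e ∈ Δ ↔
        ∃ t, A.subst (scons t e) ∈ Δ ∧ (¬ A.OnlyGlobal 0 → exi E t ∈ Δ) := by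
      rw [subst_ex, hΔ.ex_mem]
      simp only [onlyGlobal_subst_up, subst_scons]
    have hE' : ∀ d : L.Term ℕ, ![d] ∈ (canonicalModel hΔ S hS hfin hE).v (0 : ℕ) E ↔
        exi E d ∈ Δ := fun d =>
      ⟨fun h => h.2.resolve_right fun h => absurd h.1 (by decide), fun h => ⟨hE, Or.inl h⟩⟩
    rw [hi]
    refine ⟨fun h => ?_, fun ⟨d, hd, hEd⟩ => ⟨fun _ => ⟨d, (iA hA _).2 hd⟩,
      fun hl => ⟨d, (hE' d).2 (hEd hl), (iA hA _).2 hd⟩⟩⟩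
    by_cases hg : A.OnlyGlobal 0
    · obtain ⟨d, hd⟩ := h.1 hg
      exact ⟨d, (iA hA _).1 hd, fun hl => absurd hg hl⟩
    · obtain ⟨d, hEd, hd⟩ := h.2 hg
      exact ⟨d, (iA hA _).1 hd, fun _ => (hE' d).1 hEd⟩

end Truth

end SFQ

theorem mainTheorem3 (L : FirstOrder.Language.{0, 0}) [Countable L.Symbols] (E : L.Relations 1)
    (Γ : Set (SFQ.Fm L)) (hΓ : Γ.Finite) (hΓc : ∀ B ∈ Γ, B.Closed)
    (A : SFQ.Fm L) (hA : A.Closed)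
    (h : SFQ.PrevalentConsequence E Γ A) : SFQ.Derivable E Γ A := by
  refine ⟨Γ, subset_rfl, hΓ, ?_⟩
  by_contra hn
  obtain ⟨Δ, hΔ, hΓΔ, hAΔ⟩ := SFQ.exists_saturated hΓ hn
  have := SFQ.Fm.countable_relations (L := L)
  obtain ⟨code, hcode⟩ := exists_injective_nat (Σ n, L.Relations n)
  choose preds hfin hpreds using fun B : SFQ.Fm L => B.exists_finite_predsIn
  let S₀ : Set (Σ n, L.Relations n) := insert ⟨1, E⟩ (⋃ B ∈ insert A Γ, preds B)
  have hS₀ : S₀.Finite := ((hΓ.insert A).biUnion fun B _ => hfin B).insert _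
  have hsub : ∀ B ∈ insert A Γ, B.PredsIn S₀ := fun B hB =>
    (hpreds B).mono ((Set.subset_biUnion_of_mem hB).trans (Set.subset_insert _ _))
  -- The predicates of `Γ`, `A` and `E` are available from the root; any other is released once `k`
  -- exceeds its code.
  let S : ℕ → Set (Σ n, L.Relations n) := fun k => S₀ ∪ code ⁻¹' Set.Iio k
  have hS : Monotone S := fun k l hkl =>
    Set.union_subset_union_right _ (Set.preimage_mono (Set.Iio_subset_Iio hkl))
  have hSfin : ∀ k, (S k).Finite := fun k =>
    hS₀.union ((Set.finite_Iio k).preimage hcode.injOn)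
  have hE : ⟨1, E⟩ ∈ S 0 := Or.inl (Or.inl rfl)
  have hcov : ∀ P, ∃ k, P ∈ S k := fun P => ⟨code P + 1, Or.inr (Nat.lt_succ_self _)⟩
  -- Evaluating each variable as itself makes the substitution the identity.
  have root : ∀ B ∈ insert A Γ, _ := fun B hB =>
    SFQ.canonicalModel_forces_root hΔ S hS hSfin hE hcov B
      ((hsub B hB).mono Set.subset_union_left) .var
  simp only [SFQ.Fm.subst_var] at root
  refine hAΔ ((root A (Or.inl rfl)).1 (h _
    (SFQ.canonicalModel_isPrevalent hΔ S hS hSfin hE hcov) (0 : ℕ) _ ?_ ?_))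
  · rintro x ⟨B, rfl | hB, hx⟩
    · exact (hA x hx.free).elim
    · exact (hΓc B hB x hx.free).elim
  · exact fun B hB => (root B (Or.inr hB)).2 (hΓΔ hB)
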